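/- Let $\mathfrak M\subset\mathcal B(\mathcal H)$ be a von Neumann algebra on a complex Hilbert space, and call its ultraweak operator topology the $\sigma$-topology. A unital Schwartz map on $\mathfrak M$ is a $\sigma$-continuous linear map $\Psi:\mathfrak M\to\mathfrak M$ with $\Psi(1)=1$ and $0\le\Psi(a^*)\Psi(a)\le\Psi(a^*a)$ for all $a\in\mathfrak M$; its multiplicative domain is $$\mathfrak D_\Psi=\{a\in\mathfrak M:\ \Psi(a^*a)=\Psi(a^*)\Psi(a)\ \text{ and }\ \Psi(aa^*)=\Psi(a)\Psi(a^*)\}.$$ Let $(\mathfrak M,\Phi,\varphi)$ be a quantum dynamical system: $\Phi$ is a unital Schwartz map on $\mathfrak M$, $\varphi$ is a faithful normal state on $\mathfrak M$ with $\varphi\circ\Phi=\varphi$, and $\Phi$ has a $\varphi$-adjoint, i.e. a unital Schwartz map $\Phi^\sharp$ on $\mathfrak M$ with $\varphi(b\,\Phi(a))=\varphi(\Phi^\sharp(b)\,a)$ for all $a,b\in\mathfrak M$. Put $\Phi_k=\Phi^k$ for integers $k\ge 0$, $\Phi_k=(\Phi^\sharp)^{|k|}$ for integers $k<0$, and $$\mathfrak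 D_\infty=\bigcap_{k\in\mathbb Z}\mathfrak D_{\Phi_k},\qquad \mathfrak D_\infty^{\perp_\varphi}=\{a\in\mathfrak M:\ \varphi(a^*x)=0\ \text{ for all } x\in\mathfrak D_\infty\}.$$ Then: 1. For every $a\in\mathfrak M$, every $\sigma$-limit point of the orbit $\{\Phi^k(a)\}_{k\in\mathbb N}$ (that is, every cluster point, in the $\sigma$-topology, of the sequence $k\mapsto\Phi^k(a)$) belongs to $\mathfrak D_\infty$. 2. For every $d_\perp\in\mathfrak D_\infty^{\perp_\varphi}$, $$\lim_{k\to+\infty}\Phi^k(d_\perp)=0\qquad\text{and}\qquad \lim_{k\to+\infty}(\Phi^\sharp)^k(d_\perp)=0$$ in the $\sigma$-topology. -/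

import Mathlib

open scoped Topology

noncomputable section QuantumDynamics

universe u

variable {H : Type u} [NormedAddCommGroup H] [InnerProductSpace ℂ H] [CompleteSpace H]

/-- The elements of a von Neumann algebra `M` on `H`, as a unital `*`-algebra over `ℂ`. -/
abbrev VNElem (M : VonNeumannAlgebra H) : Type u := ↥M.toStarSubalgebra

/-- The functional `a ↦ ∑ₙ ⟪ξₙ, a ηₙ⟫` for square-summable sequences `ξ`, `η` in `H`. -/
def ultraweakFunctional (M : VonNeumannAlgebra H) (ξ η : lp (fun _ : ℕ => H) 2)
    (a : VNElem M) : ℂ :=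
  ∑' n : ℕ, inner ℂ (ξ n) ((a : H →L[ℂ] H) (η n))

/-- The `σ`-topology (ultraweak operator topology) of `M`: the coarsest topology that makes every
functional `a ↦ ∑ₙ ⟪ξₙ, a ηₙ⟫`, with `ξ`, `η` square-summable, continuous. -/
@[reducible] def sigmaTopology (M : VonNeumannAlgebra H) : TopologicalSpace (VNElem M) :=
  ⨅ (ξ : lp (fun _ : ℕ => H) 2) (η : lp (fun _ : ℕ => H) 2),
    TopologicalSpace.induced (ultraweakFunctional M ξ η) inferInstance

/-- `Φ` is a unital Schwartz map: linear, `σ`-continuous, `Φ(1) = 1` and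
`0 ≤ Φ(a*)Φ(a) ≤ Φ(a*a)` in the order of bounded operators. -/
structure IsUnitalSchwartz (M : VonNeumannAlgebra H) (Φ : VNElem M →ₗ[ℂ] VNElem M) : Prop where
  sigma_continuous : Continuous[sigmaTopology M, sigmaTopology M] Φ
  map_one : Φ 1 = 1
  schwartz_nonneg : ∀ a : VNElem M,
    (0 : H →L[ℂ] H) ≤ ((Φ (star a) * Φ a : VNElem M) : H →L[ℂ] H)
  schwartz_le : ∀ a : VNElem M,
    ((Φ (star a) * Φ a : VNElem M) : H →L[ℂ] H) ≤ (Φ (star a * a) : H →L[ℂ] H)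

/-- `φ` is a faithful normal state on `M`. -/
structure IsFaithfulNormalState (M : VonNeumannAlgebra H) (φ : VNElem M →ₗ[ℂ] ℂ) : Prop where
  sigma_continuous : Continuous[sigmaTopology M, inferInstance] φ
  map_one : φ 1 = 1
  nonneg_re : ∀ a : VNElem M, 0 ≤ (φ (star a * a)).re
  zero_im : ∀ a : VNElem M, (φ (star a * a)).im = 0
  faithful : ∀ a : VNElem M, φ (star a * a) = 0 → a = 0

/-- `Ψ` is a `φ`-adjoint of `Φ`: a normal unital Schwartz map with `φ(b Φ(a)) = φ(Ψ(b) a)`. -/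
structure IsStateAdjoint (M : VonNeumannAlgebra H) (φ : VNElem M →ₗ[ℂ] ℂ)
    (Φ Ψ : VNElem M →ₗ[ℂ] VNElem M) : Prop where
  schwartz : IsUnitalSchwartz M Ψ
  adjoint : ∀ a b : VNElem M, φ (b * Φ a) = φ (Ψ b * a)

/-- `(M, Φ, φ)` is a quantum dynamical system whose dynamics has the `φ`-adjoint `Φs`. -/
structure IsQuantumDynamicalSystem (M : VonNeumannAlgebra H) (Φ : VNElem M →ₗ[ℂ] VNElem M)
    (φ : VNElem M →ₗ[ℂ] ℂ) (Φs : VNElem M →ₗ[ℂ] VNElem M) : Prop where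
  schwartz : IsUnitalSchwartz M Φ
  state : IsFaithfulNormalState M φ
  stationary : ∀ a : VNElem M, φ (Φ a) = φ a
  adjoint : IsStateAdjoint M φ Φ Φs

/-- The multiplicative domain of a map `Φ`. -/
def multiplicativeDomain (M : VonNeumannAlgebra H) (Φ : VNElem M →ₗ[ℂ] VNElem M) :
    Set (VNElem M) :=
  {a | Φ (star a * a) = Φ (star a) * Φ a ∧ Φ (a * star a) = Φ a * Φ (star a)}

/-- `Φ_k = Φ^k` for `k ≥ 0` and `Φ_k = (Φs)^|k|` for `k < 0`. -/
def integerIterate (M : VonNeumannAlgebra H) (Φ Φs : VNElem M →ₗ[ℂ] VNElem M) (k : ℤ) :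
    VNElem M →ₗ[ℂ] VNElem M :=
  if 0 ≤ k then Φ ^ k.natAbs else Φs ^ k.natAbs

/-- The algebra `𝔇_∞`: the intersection over all integers `k` of the multiplicative domains
of the maps `Φ_k`. -/
def reversibleDomain (M : VonNeumannAlgebra H) (Φ Φs : VNElem M →ₗ[ℂ] VNElem M) :
    Set (VNElem M) :=
  ⋂ k : ℤ, multiplicativeDomain M (integerIterate M Φ Φs k)

/-- The `φ`-orthogonal of `R`: all `a` with `φ(a* x) = 0` for every `x ∈ R`. -/
def stateOrthogonal (M : VonNeumannAlgebra H) (φ : VNElem M →ₗ[ℂ] ℂ) (R : Set (VNElem M)) :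
    Set (VNElem M) :=
  {a | ∀ x ∈ R, φ (star a * x) = 0}

end QuantumDynamics

/-! Put `‖a‖_φ² = φ(a* a)`. The Schwartz inequality and invariance of `φ` make `Φ` and `Φs`
contractions for this norm, with `‖Φs Φ a - a‖_φ² ≤ ‖a‖_φ² - ‖Φ a‖_φ²` (`re_defect_le`). Hence, `φ`
being faithful, the multiplicative domain of `Φ` is the fixed-point set of `Φs Φ`. Along an orbit
`‖Φ^n a‖_φ` decreases to a limit, so `Φs^k Φ^k` and `Φ^k Φs^k` asymptotically fix the orbit, hence
fix its cluster points: this is part 1. For part 2, a bounded orbit converges along every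
ultrafilter. Its limit `y` lies in `𝔇_∞`, which `Φs` preserves, so `φ(y* Φ^k d) = 0` for all `k`;
hence `φ(y* y) = 0` and `y = 0`. -/

open Filter in
theorem tendsto_nhds_sigmaTopology_iff {H : Type*} [NormedAddCommGroup H] [InnerProductSpace ℂ H]
    [CompleteSpace H] {M : VonNeumannAlgebra H} {ι : Type*} {l : Filter ι} {u : ι → VNElem M}
    {y : VNElem M} :
    Tendsto u l (@nhds _ (sigmaTopology M) y) ↔
      ∀ ξ η, Tendsto (fun i => ultraweakFunctional M ξ η (u i)) l
        (𝓝 (ultraweakFunctional M ξ η y)) := by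
  simp only [nhds_iInf, nhds_induced, tendsto_iInf, tendsto_comap_iff]
  rfl

/-! ### Ultraweak compactness and square roots in `M`. -/

namespace VonNeumannAlgebra

open Filter

variable {H : Type*} [NormedAddCommGroup H] [InnerProductSpace ℂ H] [CompleteSpace H]
  {M : VonNeumannAlgebra H}

/-- The coordinatewise action of a bounded operator on square-summable sequences. -/
noncomputable def mapSeq (T : H →L[ℂ] H) (ξ : lp (fun _ : ℕ => H) 2) : lp (fun _ : ℕ => H) 2 :=
  ⟨fun n => T (ξ n), by
    have h := (lp.memℓp ξ).summable (by norm_num)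
    refine memℓp_gen (Summable.of_nonneg_of_le (fun n => by positivity) (fun n => ?_)
      (h.mul_left (‖T‖ ^ (2 : ENNReal).toReal)))
    rw [← Real.mul_rpow (norm_nonneg _) (norm_nonneg _)]
    exact Real.rpow_le_rpow (norm_nonneg _) (T.le_opNorm _) (by norm_num)⟩

theorem ultraweakFunctional_mul (b a : VNElem M) (ξ η : lp (fun _ : ℕ => H) 2) :
    ultraweakFunctional M ξ η (b * a) =
      ultraweakFunctional M (mapSeq (ContinuousLinearMap.adjoint (b : H →L[ℂ] H)) ξ) η a := by
  unfold ultraweakFunctional mapSeq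
  refine tsum_congr fun n => ?_
  simp [ContinuousLinearMap.adjoint_inner_left]

theorem sigma_continuous_mul_left (b : VNElem M) :
    Continuous[sigmaTopology M, sigmaTopology M] fun a : VNElem M => b * a := by
  let _ := sigmaTopology M
  refine continuous_iff_continuousAt.2 fun a => tendsto_nhds_sigmaTopology_iff.2 fun ξ η => ?_
  simp only [ultraweakFunctional_mul]
  exact tendsto_nhds_sigmaTopology_iff.1 tendsto_id _ _

/-- A uniformly bounded family in a von Neumann algebra `σ`-converges along any ultrafilter. -/
theorem exists_tendsto_sigma_of_bounded {ι : Type*} (g : Ultrafilter ι) (u : ι → VNElem M) (C : ℝ)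
    (hu : ∀ i, ‖(u i : H →L[ℂ] H)‖ ≤ C) :
    ∃ y : VNElem M, Tendsto u g (@nhds _ (sigmaTopology M) y) := by
  have hle : ∀ i (x z : H), ‖inner ℂ x ((u i : H →L[ℂ] H) z)‖ ≤ C * ‖x‖ * ‖z‖ := fun i x z =>
    calc _ ≤ ‖x‖ * ‖(u i : H →L[ℂ] H) z‖ := norm_inner_le_norm _ _
      _ ≤ ‖x‖ * (C * ‖z‖) := by
        gcongr
        exact ((u i : H →L[ℂ] H).le_opNorm z).trans (by gcongr; exact hu i)
      _ = _ := by ring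
  have hlim : ∀ x z : H, ∃ c : ℂ,
      Tendsto (fun i => inner ℂ x ((u i : H →L[ℂ] H) z)) g (𝓝 c) := fun x z => by
    obtain ⟨c, -, hc⟩ := (isCompact_closedBall (0 : ℂ) (C * ‖x‖ * ‖z‖)).ultrafilter_le_nhds
      (g.map fun i => inner ℂ x ((u i : H →L[ℂ] H) z))
      (by
        rw [le_principal_iff]
        exact eventually_map.2 (Eventually.of_forall fun i => by simpa using hle i x z))
    exact ⟨c, hc⟩
  choose B hB using hlim
  let L : H →ₗ⋆[ℂ] H →ₗ[ℂ] ℂ := LinearMap.mk₂'ₛₗ (starRingEnd ℂ) (RingHom.id ℂ) B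
    (fun x x' z => tendsto_nhds_unique (hB _ _)
      (by simpa only [inner_add_left] using (hB x z).add (hB x' z)))
    (fun c x z => tendsto_nhds_unique (hB _ _)
      (by simpa only [inner_smul_left, smul_eq_mul] using (hB x z).const_mul _))
    (fun x z z' => tendsto_nhds_unique (hB _ _)
      (by simpa only [map_add, inner_add_right] using (hB x z).add (hB x z')))
    (fun c x z => tendsto_nhds_unique (hB _ _)
      (by simpa only [map_smul, inner_smul_right, smul_eq_mul, RingHom.id_apply]
        using (hB x z).const_mul c))
  -- The limiting matrix coefficients form a bounded sesquilinear form, represented by an operator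
  -- `Y`; the bicommutant property puts `Y` in `M`.
  let S : H →L⋆[ℂ] H →L[ℂ] ℂ := L.mkContinuous₂ C fun x z =>
    le_of_tendsto (hB x z).norm (Eventually.of_forall (hle · x z))
  let Y : H →L[ℂ] H := ContinuousLinearMap.adjoint (InnerProductSpace.continuousLinearMapOfBilin S)
  have hY : ∀ x z : H, inner ℂ x (Y z) = B x z := fun x z => by
    rw [ContinuousLinearMap.adjoint_inner_right,
      InnerProductSpace.continuousLinearMapOfBilin_apply]
    rfl
  have hYM : Y ∈ M := by
    rw [← M.commutant_commutant, mem_commutant_iff]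
    intro T hT
    refine ContinuousLinearMap.ext fun z => ext_inner_left ℂ fun x => ?_
    have h1 : inner ℂ x ((T * Y) z) = B (ContinuousLinearMap.adjoint T x) z := by
      rw [← hY, ContinuousLinearMap.adjoint_inner_left]; rfl
    have h2 : inner ℂ x ((Y * T) z) = B x (T z) := hY _ _
    rw [h1, h2]
    refine tendsto_nhds_unique (hB _ _) ((hB x (T z)).congr fun i => ?_)
    rw [ContinuousLinearMap.adjoint_inner_left]
    have := congrArg (fun A : H →L[ℂ] H => inner ℂ x (A z)) (mem_commutant_iff.1 hT _ (u i).2)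
    exact this
  refine ⟨⟨Y, hYM⟩, tendsto_nhds_sigmaTopology_iff.2 fun ξ η => ?_⟩
  -- The uniform bound gives a summable dominating sequence, upgrading weak convergence to ultraweak
  -- convergence.
  have hs : Summable fun n => C * (‖ξ n‖ * ‖η n‖) :=
    (lp.summable_mul (by norm_num [Real.holderConjugate_iff]) ξ η).mul_left C
  refine tendsto_tsum_of_dominated_convergence hs (fun n => ?_)
    (Eventually.of_forall fun i n => ?_)
  · change Tendsto _ _ (𝓝 (inner ℂ (ξ n) (Y (η n))))
    rw [hY]
    exact hB _ _
  · rw [← mul_assoc]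
    exact hle _ _ _

/-- The square root of `x` commutes with whatever commutes with `x`, so it lies in the bicommutant.
-/
theorem exists_star_mul_self_eq (x : VNElem M) (hx : 0 ≤ (x : H →L[ℂ] H)) :
    ∃ b : VNElem M, star b * b = x := by
  have hmem : CFC.sqrt (x : H →L[ℂ] H) ∈ M := by
    suffices h : CFC.sqrt (x : H →L[ℂ] H) ∈ M.commutant.commutant by
      rwa [commutant_commutant] at h
    refine mem_commutant_iff.2 fun T hT => ?_
    have hc : Commute (x : H →L[ℂ] H) T := mem_commutant_iff.1 hT _ x.2
    exact (hc.cfcₙ_nnreal _).symm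
  refine ⟨⟨_, hmem⟩, Subtype.ext ?_⟩
  change star (CFC.sqrt (x : H →L[ℂ] H)) * CFC.sqrt (x : H →L[ℂ] H) = x
  rw [(CFC.sqrt_nonneg (x : H →L[ℂ] H)).isSelfAdjoint.star_eq, CFC.sqrt_mul_sqrt_self _ hx]

end VonNeumannAlgebra

/-! ### Unital Schwartz maps. -/

namespace IsUnitalSchwartz

variable {H : Type*} [NormedAddCommGroup H] [InnerProductSpace ℂ H] [CompleteSpace H]
  {M : VonNeumannAlgebra H} {Φ Ψ : VNElem M →ₗ[ℂ] VNElem M}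

/-- Polarization: `Φ(b*) Φ(b)` is self-adjoint for `b = a`, `a + 1` and `a + i`. -/
theorem map_star (hΦ : IsUnitalSchwartz M Φ) (a : VNElem M) : Φ (star a) = star (Φ a) := by
  have hsa : ∀ b : VNElem M, star (Φ (star b) * Φ b) = Φ (star b) * Φ b := fun b =>
    Subtype.ext (hΦ.schwartz_nonneg b).isSelfAdjoint.star_eq
  have h0 := hsa a
  have h1 := hsa (a + 1)
  have h2 := hsa (a + Complex.I • 1)
  simp only [star_add, star_smul, star_one, map_add, map_smul, hΦ.map_one, star_mul, add_mul,
    mul_add, smul_mul_assoc, mul_smul_comm, one_mul, mul_one, RCLike.star_def, Complex.conj_I,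
    neg_smul, neg_mul, map_neg, star_neg] at h0 h1 h2
  have h3 : star (Φ a) + star (Φ (star a)) = Φ (star a) + Φ a := by
    rw [h0] at h1
    linear_combination (norm := module) (1 : ℂ) • h1
  have h4 : Complex.I • (star (Φ a) - star (Φ (star a))) =
      Complex.I • (Φ (star a) - Φ a) := by
    rw [h0] at h2
    rw [smul_sub, smul_sub]
    linear_combination (norm := module) (1 : ℂ) • h2
  have h5 := smul_right_injective (VNElem M) Complex.I_ne_zero h4
  have h6 : (2 : ℂ) • Φ (star a) = (2 : ℂ) • star (Φ a) := by
    rw [two_smul, two_smul]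
    linear_combination (norm := module) (-1 : ℂ) • h3 - (1 : ℂ) • h5
  exact smul_right_injective (VNElem M) (two_ne_zero (α := ℂ)) h6

theorem map_nonneg (hΦ : IsUnitalSchwartz M Φ) {x : VNElem M} (hx : 0 ≤ (x : H →L[ℂ] H)) :
    0 ≤ (Φ x : H →L[ℂ] H) := by
  obtain ⟨b, rfl⟩ := VonNeumannAlgebra.exists_star_mul_self_eq x hx
  exact (hΦ.schwartz_nonneg b).trans (hΦ.schwartz_le b)

theorem map_mono (hΦ : IsUnitalSchwartz M Φ) {x y : VNElem M}
    (h : (x : H →L[ℂ] H) ≤ (y : H →L[ℂ] H)) : (Φ x : H →L[ℂ] H) ≤ (Φ y : H →L[ℂ] H) := by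
  have := hΦ.map_nonneg (x := y - x) (by simpa using h)
  simpa using this

theorem norm_map_le (hΦ : IsUnitalSchwartz M Φ) (a : VNElem M) :
    ‖(Φ a : H →L[ℂ] H)‖ ≤ ‖(a : H →L[ℂ] H)‖ := by
  set r : ℝ := ‖(a : H →L[ℂ] H)‖ with hr
  have halg : ∀ s : ℝ, algebraMap ℝ (H →L[ℂ] H) s = ((s : ℂ) • (1 : VNElem M) : VNElem M) :=
    fun s => by
      rw [Algebra.algebraMap_eq_smul_one]
      simp [Complex.coe_smul]
  have h1 : ((star a * a : VNElem M) : H →L[ℂ] H) ≤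
      (((r ^ 2 : ℝ) : ℂ) • (1 : VNElem M) : VNElem M) := by
    rw [← halg]
    exact CStarAlgebra.star_mul_le_algebraMap_norm_sq
  have h2 := (hΦ.schwartz_le a).trans (hΦ.map_mono h1)
  rw [map_smul, hΦ.map_one, ← halg, hΦ.map_star] at h2
  have h3 : ‖(star (Φ a : H →L[ℂ] H)) * (Φ a : H →L[ℂ] H)‖ ≤ r ^ 2 :=
    (CStarAlgebra.norm_le_iff_le_algebraMap _ (by positivity) (star_mul_self_nonneg _)).2 h2
  rw [CStarRing.norm_star_mul_self, ← sq] at h3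
  exact (pow_le_pow_iff_left₀ (norm_nonneg _) (norm_nonneg _) two_ne_zero).1 h3

theorem id : IsUnitalSchwartz M (1 : VNElem M →ₗ[ℂ] VNElem M) where
  sigma_continuous := @continuous_id _ (sigmaTopology M)
  map_one := rfl
  schwartz_nonneg a := star_mul_self_nonneg (a : H →L[ℂ] H)
  schwartz_le _ := le_rfl

theorem comp (hΦ : IsUnitalSchwartz M Φ) (hΨ : IsUnitalSchwartz M Ψ) :
    IsUnitalSchwartz M (Φ * Ψ) where
  sigma_continuous := @Continuous.comp _ _ _ (sigmaTopology M) (sigmaTopology M) (sigmaTopology M)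
    Ψ Φ hΦ.sigma_continuous hΨ.sigma_continuous
  map_one := by simp [hΦ.map_one, hΨ.map_one]
  schwartz_nonneg a := by
    have := hΦ.schwartz_nonneg (Ψ a)
    rwa [← hΨ.map_star] at this
  schwartz_le a := by
    have := hΦ.schwartz_le (Ψ a)
    rw [← hΨ.map_star] at this
    exact this.trans (hΦ.map_mono (hΨ.schwartz_le a))

theorem pow (hΦ : IsUnitalSchwartz M Φ) (k : ℕ) : IsUnitalSchwartz M (Φ ^ k) := by
  induction k with
  | zero => exact id
  | succ k ih => rw [pow_succ]; exact ih.comp hΦ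

end IsUnitalSchwartz

/-! ### Faithful normal states. -/

namespace IsFaithfulNormalState

variable {H : Type*} [NormedAddCommGroup H] [InnerProductSpace ℂ H] [CompleteSpace H]
  {M : VonNeumannAlgebra H} {φ : VNElem M →ₗ[ℂ] ℂ}

theorem map_star (hφ : IsFaithfulNormalState M φ) (a : VNElem M) :
    φ (star a) = starRingEnd ℂ (φ a) := by
  have h0 := hφ.zero_im a
  have h1 := hφ.zero_im (a + 1)
  have h2 := hφ.zero_im (a + Complex.I • 1)
  simp only [star_add, star_smul, star_one, map_add, map_smul, hφ.map_one, add_mul, mul_add,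
    smul_mul_assoc, mul_smul_comm, one_mul, mul_one, RCLike.star_def, Complex.conj_I,
    smul_eq_mul, neg_smul, neg_mul, map_neg] at h1 h2
  simp [h0] at h1 h2
  refine Complex.ext ?_ ?_ <;> simp <;> linarith

/-- The semi-inner product `(a, b) ↦ φ(a* b)`. -/
@[reducible] noncomputable def innerCore (hφ : IsFaithfulNormalState M φ) :
    PreInnerProductSpace.Core ℂ (VNElem M) where
  inner a b := φ (star a * b)
  conj_inner_symm a b := by rw [← hφ.map_star, star_mul, star_star]
  re_inner_nonneg a := hφ.nonneg_re a
  add_left a b c := by simp [add_mul]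
  smul_left a b r := by simp

theorem norm_sq_le (hφ : IsFaithfulNormalState M φ) (a b : VNElem M) :
    ‖φ (star a * b)‖ ^ 2 ≤ (φ (star a * a)).re * (φ (star b * b)).re := by
  have h := @InnerProductSpace.Core.inner_mul_inner_self_le ℂ (VNElem M) _ _ _ hφ.innerCore a b
  have h' : ‖φ (star b * a)‖ = ‖φ (star a * b)‖ := by
    rw [← RCLike.norm_conj (φ (star a * b)), ← hφ.map_star, star_mul, star_star]
  rw [sq]
  nth_rewrite 2 [← h']
  exact h

theorem eq_zero_of_re_le (hφ : IsFaithfulNormalState M φ) {a : VNElem M}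
    (h : (φ (star a * a)).re ≤ 0) : a = 0 :=
  hφ.faithful a (Complex.ext (le_antisymm h (hφ.nonneg_re a)) (hφ.zero_im a))

theorem re_nonneg (hφ : IsFaithfulNormalState M φ) {x : VNElem M} (hx : 0 ≤ (x : H →L[ℂ] H)) :
    0 ≤ (φ x).re := by
  obtain ⟨b, rfl⟩ := VonNeumannAlgebra.exists_star_mul_self_eq x hx
  exact hφ.nonneg_re b

theorem eq_zero_of_nonneg (hφ : IsFaithfulNormalState M φ) {x : VNElem M}
    (hx : 0 ≤ (x : H →L[ℂ] H)) (h : φ x = 0) : x = 0 := by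
  obtain ⟨b, rfl⟩ := VonNeumannAlgebra.exists_star_mul_self_eq x hx
  rw [hφ.faithful b h, mul_zero]

end IsFaithfulNormalState

/-! ### Contraction in the norm of `φ`, and multiplicative domains. -/

namespace IsQuantumDynamicalSystem

open Filter

variable {H : Type*} [NormedAddCommGroup H] [InnerProductSpace ℂ H] [CompleteSpace H]
  {M : VonNeumannAlgebra H} {Φ Φs : VNElem M →ₗ[ℂ] VNElem M} {φ : VNElem M →ₗ[ℂ] ℂ}

theorem swap (h : IsQuantumDynamicalSystem M Φ φ Φs) : IsQuantumDynamicalSystem M Φs φ Φ where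
  schwartz := h.adjoint.schwartz
  state := h.state
  stationary b := by
    have := h.adjoint.adjoint 1 b
    rwa [h.schwartz.map_one, mul_one, mul_one, eq_comm] at this
  adjoint :=
    { schwartz := h.schwartz
      adjoint := fun a b => by
        have := congrArg (starRingEnd ℂ) (h.adjoint.adjoint (star b) (star a))
        rw [← h.state.map_star, ← h.state.map_star] at this
        simpa [h.schwartz.map_star, h.adjoint.schwartz.map_star] using this.symm }

theorem pow (h : IsQuantumDynamicalSystem M Φ φ Φs) (k : ℕ) :
    IsQuantumDynamicalSystem M (Φ ^ k) φ (Φs ^ k) where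
  schwartz := h.schwartz.pow k
  state := h.state
  stationary a := by
    induction k with
    | zero => rfl
    | succ k ih => rw [pow_succ', Module.End.mul_apply, h.stationary, ih]
  adjoint :=
    { schwartz := h.adjoint.schwartz.pow k
      adjoint := fun a b => by
        induction k generalizing b with
        | zero => rfl
        | succ k ih =>
          rw [pow_succ', Module.End.mul_apply, h.adjoint.adjoint, ih, pow_succ,
            Module.End.mul_apply] }

theorem re_map_le (h : IsQuantumDynamicalSystem M Φ φ Φs) (a : VNElem M) :
    (φ (star (Φ a) * Φ a)).re ≤ (φ (star a * a)).re := by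
  have := h.state.re_nonneg (x := Φ (star a * a) - Φ (star a) * Φ a)
    (by simpa using h.schwartz.schwartz_le a)
  rw [map_sub, h.stationary, h.schwartz.map_star, Complex.sub_re] at this
  linarith

/-- Expand the square: each cross term has real part `‖Φ a‖_φ²`, and `‖Φs Φ a‖_φ ≤ ‖Φ a‖_φ`. -/
theorem re_defect_le (h : IsQuantumDynamicalSystem M Φ φ Φs) (a : VNElem M) :
    (φ (star (Φs (Φ a) - a) * (Φs (Φ a) - a))).re ≤
      (φ (star a * a)).re - (φ (star (Φ a) * Φ a)).re := by
  have h1 : φ (star a * Φs (Φ a)) = φ (star (Φ a) * Φ a) := by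
    rw [h.swap.adjoint.adjoint, h.schwartz.map_star]
  have h2 : φ (star (Φs (Φ a)) * a) = starRingEnd ℂ (φ (star (Φ a) * Φ a)) := by
    rw [← h1, ← h.state.map_star, star_mul, star_star]
  have h3 := h.swap.re_map_le (Φ a)
  simp only [star_sub, sub_mul, mul_sub, map_sub, h1, h2, Complex.sub_re, Complex.conj_re]
  linarith

theorem adjoint_map_eq_of_re_le (h : IsQuantumDynamicalSystem M Φ φ Φs) {a : VNElem M}
    (ha : (φ (star a * a)).re ≤ (φ (star (Φ a) * Φ a)).re) : Φs (Φ a) = a :=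
  sub_eq_zero.1 (h.state.eq_zero_of_re_le ((h.re_defect_le a).trans (by linarith)))

/-- The Schwartz defect is positive and its state is `‖a‖_φ² - ‖Φ a‖_φ²`. -/
theorem map_star_mul_self_eq_iff (h : IsQuantumDynamicalSystem M Φ φ Φs) (a : VNElem M) :
    Φ (star a * a) = Φ (star a) * Φ a ↔ Φs (Φ a) = a := by
  constructor
  · intro ha
    apply h.adjoint_map_eq_of_re_le
    rw [← h.schwartz.map_star, ← ha, h.stationary]
  · intro ha
    refine sub_eq_zero.1 (h.state.eq_zero_of_nonneg (by simpa using h.schwartz.schwartz_le a) ?_)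
    rw [map_sub, h.stationary, ← h.swap.adjoint.adjoint, ha, sub_self]

theorem mem_multiplicativeDomain_iff (h : IsQuantumDynamicalSystem M Φ φ Φs) (a : VNElem M) :
    a ∈ multiplicativeDomain M Φ ↔ Φs (Φ a) = a := by
  have h2 := h.map_star_mul_self_eq_iff (star a)
  rw [star_star] at h2
  refine (and_congr (h.map_star_mul_self_eq_iff a) h2).trans
    ⟨And.left, fun ha => ⟨ha, ?_⟩⟩
  rw [h.schwartz.map_star, h.adjoint.schwartz.map_star, ha]

theorem mem_reversibleDomain_iff (h : IsQuantumDynamicalSystem M Φ φ Φs) (a : VNElem M) :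
    a ∈ reversibleDomain M Φ Φs ↔
      ∀ k : ℕ, (Φs ^ k) ((Φ ^ k) a) = a ∧ (Φ ^ k) ((Φs ^ k) a) = a := by
  simp only [reversibleDomain, Set.mem_iInter]
  constructor
  · intro ha k
    refine ⟨((h.pow k).mem_multiplicativeDomain_iff a).1 ?_, ?_⟩
    · simpa [integerIterate] using ha k
    -- At `k = 0` the index `-k` falls in the nonnegative branch of `integerIterate`.
    · rcases Nat.eq_zero_or_pos k with rfl | hk
      · rfl
      refine ((h.swap.pow k).mem_multiplicativeDomain_iff a).1 ?_
      simpa [integerIterate, hk.ne'] using ha (-k)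
  · intro ha k
    unfold integerIterate
    split_ifs
    · exact ((h.pow _).mem_multiplicativeDomain_iff a).2 (ha _).1
    · exact ((h.swap.pow _).mem_multiplicativeDomain_iff a).2 (ha _).2

theorem mem_reversibleDomain_swap_iff (h : IsQuantumDynamicalSystem M Φ φ Φs) (a : VNElem M) :
    a ∈ reversibleDomain M Φs Φ ↔ a ∈ reversibleDomain M Φ Φs := by
  rw [h.mem_reversibleDomain_iff, h.swap.mem_reversibleDomain_iff]
  exact forall_congr' fun k => and_comm

theorem adjoint_mem_reversibleDomain (h : IsQuantumDynamicalSystem M Φ φ Φs) {x : VNElem M}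
    (hx : x ∈ reversibleDomain M Φ Φs) : Φs x ∈ reversibleDomain M Φ Φs := by
  rw [h.mem_reversibleDomain_iff] at hx ⊢
  intro k
  constructor
  · rcases k with _ | k
    · rfl
    · have h1 : Φ (Φs x) = x := by simpa using (hx 1).2
      rw [pow_succ Φ, Module.End.mul_apply, h1, pow_succ', Module.End.mul_apply, (hx k).1]
  -- `Φs^k` loses no norm on `Φs x`, since `‖Φs x‖_φ ≤ ‖x‖_φ = ‖Φ^(k+1) Φs^(k+1) x‖_φ ≤ ‖Φs^k Φs
  -- x‖_φ`.
  · refine (h.swap.pow k).adjoint_map_eq_of_re_le ?_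
    have h1 := (h.pow (k + 1)).re_map_le ((Φs ^ (k + 1)) x)
    rw [(hx (k + 1)).2, pow_succ, Module.End.mul_apply] at h1
    exact (h.swap.re_map_le x).trans h1

theorem pow_adjoint_mem_reversibleDomain (h : IsQuantumDynamicalSystem M Φ φ Φs) {x : VNElem M}
    (hx : x ∈ reversibleDomain M Φ Φs) (k : ℕ) : (Φs ^ k) x ∈ reversibleDomain M Φ Φs := by
  induction k with
  | zero => exact hx
  | succ k ih =>
    rw [pow_succ', Module.End.mul_apply]
    exact h.adjoint_mem_reversibleDomain ih

/-! ### Asymptotics of orbits. -/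

theorem sigma_continuous_state_mul (h : IsQuantumDynamicalSystem M Φ φ Φs) (b : VNElem M) :
    Continuous[sigmaTopology M, inferInstance] fun w : VNElem M => φ (b * w) :=
  @Continuous.comp _ _ _ (sigmaTopology M) (sigmaTopology M) _ _ _ h.state.sigma_continuous
    (VonNeumannAlgebra.sigma_continuous_mul_left b)

/-- If `T` is `σ`-continuous and `T` almost fixes the sequence `u` in the norm of `φ`, then `T`
fixes all `σ`-cluster points of `u`. -/
theorem eq_of_mapClusterPt (h : IsQuantumDynamicalSystem M Φ φ Φs)
    {T : VNElem M → VNElem M} (hT : Continuous[sigmaTopology M, sigmaTopology M] T)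
    {u : ℕ → VNElem M} {y : VNElem M} (hy : @MapClusterPt _ (sigmaTopology M) _ y atTop u)
    (hu : Tendsto (fun n => (φ (star (T (u n) - u n) * (T (u n) - u n))).re) atTop (𝓝 0)) :
    T y = y := by
  let _ := sigmaTopology M
  have key : ∀ b : VNElem M, φ (star b * (T y - y)) = 0 := fun b => by
    have hc : Continuous fun w : VNElem M => φ (star b * T w) - φ (star b * w) :=
      ((h.sigma_continuous_state_mul (star b)).comp hT).sub (h.sigma_continuous_state_mul (star b))
    have hcl := hy.continuousAt_comp hc.continuousAt
    have hlim : Tendsto ((fun w : VNElem M => φ (star b * T w) - φ (star b * w)) ∘ u) atTop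
        (𝓝 0) := by
      have h1 : Tendsto (fun n => ‖φ (star b * (T (u n) - u n))‖ ^ 2) atTop (𝓝 0) := by
        refine squeeze_zero (fun n => by positivity) (fun n => h.state.norm_sq_le _ _) ?_
        simpa using hu.const_mul (φ (star b * b)).re
      have h2 := h1.sqrt
      simp only [Real.sqrt_sq (norm_nonneg _), Real.sqrt_zero] at h2
      refine tendsto_zero_iff_norm_tendsto_zero.2 (h2.congr fun n => ?_)
      simp [mul_sub]
    have : (φ (star b * T y) - φ (star b * y)) = 0 :=
      eq_of_nhds_neBot (hcl.clusterPt.mono hlim)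
    rwa [mul_sub, map_sub]
  exact sub_eq_zero.1 (h.state.faithful _ (key _))

theorem tendsto_re_defect (h : IsQuantumDynamicalSystem M Φ φ Φs) (a : VNElem M) (k : ℕ) :
    Tendsto (fun n => (φ (star ((Φs ^ k) ((Φ ^ k) ((Φ ^ n) a)) - (Φ ^ n) a) *
      ((Φs ^ k) ((Φ ^ k) ((Φ ^ n) a)) - (Φ ^ n) a))).re) atTop (𝓝 0) := by
  let q : ℕ → ℝ := fun n => (φ (star ((Φ ^ n) a) * (Φ ^ n) a)).re
  have hanti : Antitone q := antitone_nat_of_succ_le fun n => by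
    simpa only [q, pow_succ', Module.End.mul_apply] using h.re_map_le ((Φ ^ n) a)
  have hq : Tendsto q atTop (𝓝 (⨅ n, q n)) :=
    tendsto_atTop_ciInf hanti ⟨0, by rintro _ ⟨n, rfl⟩; exact h.state.nonneg_re _⟩
  have hd : Tendsto (fun n => q n - q (n + k)) atTop (𝓝 0) := by
    simpa using hq.sub (hq.comp (tendsto_add_atTop_nat k))
  refine squeeze_zero (fun n => h.state.nonneg_re _) (fun n => ?_) hd
  have := (h.pow k).re_defect_le ((Φ ^ n) a)
  simp only [q]
  rwa [add_comm n k, pow_add, Module.End.mul_apply]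

theorem mem_reversibleDomain_of_mapClusterPt (h : IsQuantumDynamicalSystem M Φ φ Φs)
    {a y : VNElem M}
    (hy : @MapClusterPt _ (sigmaTopology M) _ y atTop fun k : ℕ => (Φ ^ k) a) :
    y ∈ reversibleDomain M Φ Φs := by
  rw [h.mem_reversibleDomain_iff]
  intro k
  constructor
  · exact h.eq_of_mapClusterPt
      ((h.adjoint.schwartz.pow k).comp (h.schwartz.pow k)).sigma_continuous hy
      (h.tendsto_re_defect a k)
  -- After shifting `n` by `k`, the defect of `Φ^k Φs^k` is the image under `Φ^k` of the defect of
  -- `Φs^k Φ^k` at `Φ^n a`.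
  · refine h.eq_of_mapClusterPt
      ((h.schwartz.pow k).comp (h.adjoint.schwartz.pow k)).sigma_continuous hy
      ((tendsto_add_atTop_iff_nat k).1 ?_)
    refine squeeze_zero (fun n => h.state.nonneg_re _) (fun n => ?_) (h.tendsto_re_defect a k)
    have := (h.pow k).re_map_le ((Φs ^ k) ((Φ ^ k) ((Φ ^ n) a)) - (Φ ^ n) a)
    rw [map_sub] at this
    rwa [add_comm n k, pow_add, Module.End.mul_apply]

theorem tendsto_zero_of_mem_stateOrthogonal (h : IsQuantumDynamicalSystem M Φ φ Φs)
    {d : VNElem M} (hd : d ∈ stateOrthogonal M φ (reversibleDomain M Φ Φs)) :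
    Tendsto (fun k : ℕ => (Φ ^ k) d) atTop (@nhds _ (sigmaTopology M) 0) := by
  rw [tendsto_iff_ultrafilter]
  intro g hg
  obtain ⟨y, hy⟩ := VonNeumannAlgebra.exists_tendsto_sigma_of_bounded g (fun k => (Φ ^ k) d) _
    fun k => (h.schwartz.pow k).norm_map_le d
  let _ := sigmaTopology M
  have hyD : y ∈ reversibleDomain M Φ Φs :=
    h.mem_reversibleDomain_of_mapClusterPt (hy.mapClusterPt.mono hg)
  have horth : φ (star y * y) = 0 := by
    refine tendsto_nhds_unique
      (((h.sigma_continuous_state_mul (star y)).tendsto y).comp hy) ?_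
    -- `φ(y* Φ^k d)` is the conjugate of `φ(d* Φs^k y)`, which vanishes because `Φs^k y` stays in
    -- `𝔇_∞`.
    refine tendsto_const_nhds.congr fun k => ?_
    have := hd _ (h.pow_adjoint_mem_reversibleDomain hyD k)
    rw [(h.swap.pow k).adjoint.adjoint, (h.schwartz.pow k).map_star] at this
    have h2 := congrArg (starRingEnd ℂ) this
    rw [← h.state.map_star, star_mul, star_star, map_zero] at h2
    exact h2.symm
  rwa [h.state.faithful y horth] at hy

end IsQuantumDynamicalSystem

theorem mainTheorem5 {H : Type*} [NormedAddCommGroup H] [InnerProductSpace ℂ H] [CompleteSpace H]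
    (M : VonNeumannAlgebra H) (Φ Φs : VNElem M →ₗ[ℂ] VNElem M) (φ : VNElem M →ₗ[ℂ] ℂ)
    (hsys : IsQuantumDynamicalSystem M Φ φ Φs) :
    (∀ a y : VNElem M,
      @MapClusterPt (VNElem M) (sigmaTopology M) ℕ y Filter.atTop (fun k : ℕ => (Φ ^ k) a) →
        y ∈ reversibleDomain M Φ Φs) ∧
    (∀ d ∈ stateOrthogonal M φ (reversibleDomain M Φ Φs),
      Filter.Tendsto (fun k : ℕ => (Φ ^ k) d) Filter.atTop (@nhds (VNElem M) (sigmaTopology M) 0) ∧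
      Filter.Tendsto (fun k : ℕ => (Φs ^ k) d) Filter.atTop
        (@nhds (VNElem M) (sigmaTopology M) 0)) := by
  refine ⟨fun a y hy => hsys.mem_reversibleDomain_of_mapClusterPt hy, fun d hd =>
    ⟨hsys.tendsto_zero_of_mem_stateOrthogonal hd,
      hsys.swap.tendsto_zero_of_mem_stateOrthogonal fun x hx => hd x ?_⟩⟩
  exact (hsys.mem_reversibleDomain_swap_iff x).1 hx
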